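/- Let $c=\cos(\pi/5)$ and let Mom be the regular pentagon with centre $0$, radius $1$ and a vertex at $(0,1)$. Let $\tau$ be the outer billiard map (Tangent map) of Mom: $\tau(p)=2v-p$, where $v$ is the vertex such that all other vertices lie strictly to the right of the oriented line from $p$ through $v$; $\tau(p)$ is undefined if there is no such $v$. Put $$\mathrm{GenScale}=\frac{1-c}{c},\qquad \mathrm{GenStar}=\bigl(-\cot(\pi/5)\,(1+c),\,-c\bigr).$$ Let $\mathrm{Dad}[0]$ be the regular decagon with the side length of Mom (hence height, i.e. apothem, $1+c$), with centre $-\tfrac1c\,\mathrm{GenStar}$ and with a horizontal bottom edge; for $k\ge 1$ let the generation-$k$ decagon $\mathrm{Dad}[k]$ be the image of $\mathrm{Dad}[0]$ under the homothety with centre $\mathrm{GenStar}$ and ratio $\mathrm{GenScale}^k$. The period of $\mathrm{Dad}[k]$ under $\tau$ is the least period of its centre. Let $\theta=2\pi/10$, $a=2\cos\theta$, and let $\mathrm{Df}(x,y)=(y,\,f(-x+ay))$ be the digital filter map, where $f(z)=((z+1)\bmod 2)-1\in[-1,1)$. Let $\mathrm{cDad}[k]$ be the image of the centre of $\mathrm{Dad}[k]$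 under the similarity $p\mapsto r\,(p-p_0)$, where $p_0$ is the centre of $\mathrm{Dad}[0]$ and $r=1/(1+c)$ (so that $\mathrm{Dad}[0]$ becomes the decagon centred at $0$ with height $1$), and let $\mathrm{TsToDf}(x,y)=(y,\;y\cos\theta-x\sin\theta)$. Then for every integer $k\ge 1$ the centre of $\mathrm{Dad}[k]$ is periodic under $\tau$, the point $\mathrm{TsToDf}[\mathrm{cDad}[k]]$ is periodic under $\mathrm{Df}$, and their least periods satisfy $$\mathrm{Period}[\mathrm{Dad}[k]]=2\cdot \mathrm{Period}[\mathrm{TsToDf}[\mathrm{cDad}[k]]]+(-1)^{k}.$$ Moreover the outer billiard period of $\mathrm{Dad}[k]$ is $$P[k]=\tfrac57\bigl(8\cdot 6^{k-1}+(-1)^k\bigr).$$ -/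

import Mathlib

noncomputable section

namespace OuterBilliard

/-! ### Regular polygons in the plane -/

/-- A regular polygon: number of sides, centre, circumscribed radius, and the polar angle, seen from
the centre, of its first vertex. -/
structure RegularPolygon where
  sides : ℕ
  center : ℝ × ℝ
  radius : ℝ
  angle : ℝ

/-- The vertices, listed clockwise. -/
def RegularPolygon.vertex (P : RegularPolygon) (j : Fin P.sides) : ℝ × ℝ :=
  (P.center.1 + P.radius * Real.cos (P.angle - 2 * Real.pi * (j : ℝ) / P.sides),
   P.center.2 + P.radius * Real.sin (P.angle - 2 * Real.pi * (j : ℝ) / P.sides))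

/-! ### The Tangent map (outer billiards) -/

/-- `IsContact P p c`: `c` is a vertex of `P`, and all the other vertices lie strictly to the right
of the oriented line from `p` through `c`. So the tangent segment from `p` follows the clockwise
orientation of `P` and touches `P` at the single point `c`. -/
def IsContact (P : RegularPolygon) (p c : ℝ × ℝ) : Prop :=
  ∃ j : Fin P.sides, c = P.vertex j ∧ ∀ i : Fin P.sides, i ≠ j →
    (c.1 - p.1) * ((P.vertex i).2 - p.2) - (c.2 - p.2) * ((P.vertex i).1 - p.1) < 0

open Classical in
/-- The Tangent map `τ(p) = -p + 2c`, where `c` is the point of contact. The value is `none` when `p`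
has no (unique) point of contact: `p` lies in `P` or on an extended trailing edge of `P`. -/
def tangentMap (P : RegularPolygon) (p : ℝ × ℝ) : Option (ℝ × ℝ) :=
  if h : ∃ c, IsContact P p c then some (-p + (2 : ℝ) • h.choose) else none

/-- The (prime) period of a point under the Tangent map. It is positive exactly when all the iterates
of `p` are defined and `p` returns to itself; it is then the least positive return time. -/
def tangentPeriod (P : RegularPolygon) (p : ℝ × ℝ) : ℕ :=
  Function.minimalPeriod (fun o : Option (ℝ × ℝ) => o.bind (tangentMap P)) (some p)

/-- The period of a region, which by convention is the period of its centre. -/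
def regionPeriod (P Q : RegularPolygon) : ℕ :=
  tangentPeriod P Q.center

/-! ### The digital filter map -/

/-- The sawtooth `f(z) = Mod[z + 1, 2] - 1`, with values in `[-1, 1)`. -/
def sawtooth (z : ℝ) : ℝ :=
  ((z + 1) - 2 * (⌊(z + 1) / 2⌋ : ℝ)) - 1

/-- The digital filter map `Df(x, y) = (y, f(-x + a y))` with `a = 2 cos θ`. -/
def digitalFilter (θ : ℝ) (p : ℝ × ℝ) : ℝ × ℝ :=
  (p.2, sawtooth (-p.1 + 2 * Real.cos θ * p.2))

/-- The (prime) period of a point under `Df`; it is `0` for a point that is not periodic. -/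
def dfPeriod (θ : ℝ) (p : ℝ × ℝ) : ℕ :=
  Function.minimalPeriod (digitalFilter θ) p

/-- `G(x, y) = (x, x cos θ + y sin θ)`, which conjugates the rotation by `-θ` to the linear part of
the digital filter map. -/
def conjG (θ : ℝ) (p : ℝ × ℝ) : ℝ × ℝ :=
  (p.1, p.1 * Real.cos θ + p.2 * Real.sin θ)

/-- The passage `TsToDf` from Tangent space to digital filter space: the rotation by `-π/2`,
`(x, y) ↦ (y, -x)`, followed by `G`. -/
def tsToDf (θ : ℝ) (p : ℝ × ℝ) : ℝ × ℝ :=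
  conjG θ (p.2, -p.1)

/-! ### The regular pentagon and its generations of Dads -/

/-- Mom: the regular pentagon of radius `1`, centred at the origin, with a vertex at `(0, 1)`. -/
def mom : RegularPolygon where
  sides := 5
  center := 0
  radius := 1
  angle := Real.pi / 2

/-- The factor by which the generations scale. -/
def genScale : ℝ :=
  (1 - Real.cos (Real.pi / 5)) / Real.cos (Real.pi / 5)

/-- The point to which the generations converge. It is a tip of the pentagram that the extended sides
of Mom form. -/
def genStar : ℝ × ℝ :=
  (-(Real.cos (Real.pi / 5) / Real.sin (Real.pi / 5)) * (1 + Real.cos (Real.pi / 5)),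
   -Real.cos (Real.pi / 5))

/-- The height (apothem) of `Dad[k]`. For `k = 0` this is the height of the regular decagon that has
the same side length as Mom. -/
def dadHeight (k : ℕ) : ℝ :=
  (1 + Real.cos (Real.pi / 5)) * genScale ^ k

/-- The centre of the right-side Dad, `Dad[0]`: the decagon whose side length is that of Mom, whose
bottom edge lies on the line through the bottom edge of Mom, and whose centre lies on the line from
`genStar` through the centre of Mom. -/
def dadZeroCenter : ℝ × ℝ :=
  -((1 / Real.cos (Real.pi / 5)) • genStar)

/-- `Dad[k]`: the regular decagon that is the image of `Dad[0]` under the homothety with centre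
`genStar` and ratio `genScale ^ k`. -/
def dad (k : ℕ) : RegularPolygon where
  sides := 10
  center := genStar + genScale ^ k • (dadZeroCenter - genStar)
  radius := dadHeight k / Real.cos (Real.pi / 10)
  angle := 0

/-! ### Passage from the pentagon to the decagon -/

/-- The radius of Mom when the picture is scaled so that `Dad[0]` has height `1`. -/
def rMom : ℝ :=
  1 / dadHeight 0

/-- The centre of Mom when the picture is also translated so that `Dad[0]` is centred at `0`. -/
def cMom : ℝ × ℝ :=
  -(rMom • (dad 0).center)

/-- The canonical map from the coordinates of the pentagon (Mom at the origin with radius `1`) to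
those of the decagon (Dad at the origin with height `1`). -/
def kTo2k (p : ℝ × ℝ) : ℝ × ℝ :=
  rMom • p + cMom

/-- The point `cDad[k]`: the centre of `Dad[k]` in the coordinates of the decagon. -/
def cDad (k : ℕ) : ℝ × ℝ :=
  kTo2k (dad k).center

end OuterBilliard

end

/-!
The tangent map of the pentagon and the digital filter map induce the same map on a small
triangle, and this map renormalizes; both families of periods are read off from one substitution.

The triangle is the tip of the pentagram at `genStar`. In coordinates `(u, v)` adapted to its two
long sides it is `tip`, and the centre of `Dad[k]` is `(δ ^ k, δ ^ k)` with `δ = genScale = φ⁻³`.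
A line cuts the tip into two pieces `tipA` and `tipB`. The digital filter map returns to the tip
(moved to the corner `(-1, 1)` of its square) after `3` steps from `tipA` and `4` steps from
`tipB` (`isReturnSystem_tipToDf`). The tangent map returns to the union of the five tips of the
pentagram after `1` step from `tipA`, shifting the tip by `1`, and after `2` steps from `tipB`,
shifting it by `3` (`isReturnSystem_armToPlane`). Up to the shift, the return map is the same
piecewise rotation `tipMap` in both cases.

Scaling by `δ` about the apex, combined with the reflection in the axis of the tip, conjugates
`tipMap` to its own first-return map on the scaled tip (`isReturnSystem_tipScale`); an excursion
from the image of `tipA` visits `tipA` and `tipB` `3` and `2` times, one from the image of `tipB`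
visits them `6` and `2` times. The centre of `Dad[1]` is a fixed point of `tipMap` in `tipA`, and
the scaling takes each centre to the next. So the numbers `(a, b)` of visits in one period of the
centre of `Dad[k]` start with `(1, 0)` and follow `(a, b) ↦ (3 a + 6 b, 2 a + 2 b)`, a matrix with
eigenvalues `6` and `-1`.

A first-return system determines least periods, not only return times
(`IsReturnSystem.minimalPeriod_eq`). The digital filter period is therefore `3 a + 4 b`. The total
shift `a + 3 b` is never divisible by `5`, so that the orbit under the tangent map closes up only
after five turns and its period is `5 (a + 2 b)`. The two claims reduce to `2 b - a = (-1) ^ k`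
and `7 (a + 2 b) = 8 * 6 ^ (k - 1) + (-1) ^ k`.
-/

noncomputable section

namespace OuterBilliard

open Function
open scoped goldenRatio

/-! ### First-return systems and periods -/

/-- `G`, read through the coordinates `ι`, is the first-return map of `f` to `Z`, with return time
`r`, at every point of the `G`-invariant set `D` of coordinates. -/
structure IsReturnSystem {α β : Type*} (f : α → α) (Z : Set α) (G : β → β) (ι : β → α)
    (r : β → ℕ) (D : Set β) : Prop where
  mapsTo : Set.MapsTo G D D
  injOn : Set.InjOn ι D
  pos : ∀ b ∈ D, 0 < r b
  mem : ∀ b ∈ D, ι b ∈ Z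
  iterate_eq : ∀ b ∈ D, f^[r b] (ι b) = ι (G b)
  notMem : ∀ b ∈ D, ∀ j, 0 < j → j < r b → f^[j] (ι b) ∉ Z

theorem birkhoffSum_mono {β : Type*} (G : β → β) (r : β → ℕ) (b : β) :
    Monotone fun n => birkhoffSum G r n b :=
  fun _ _ h => Finset.sum_le_sum_of_subset (Finset.range_mono h)

namespace IsReturnSystem

variable {α β : Type*} {f : α → α} {Z : Set α} {G : β → β} {ι : β → α} {r : β → ℕ} {D : Set β}

theorem iterate_mem (h : IsReturnSystem f Z G ι r D) {b : β} (hb : b ∈ D) (m : ℕ) :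
    G^[m] b ∈ D :=
  h.mapsTo.iterate m hb

theorem iterate_birkhoffSum (h : IsReturnSystem f Z G ι r D) {b : β} (hb : b ∈ D) (m : ℕ) :
    f^[birkhoffSum G r m b] (ι b) = ι (G^[m] b) := by
  induction m with
  | zero => simp
  | succ m ih =>
    rw [birkhoffSum_succ, add_comm, iterate_add_apply, ih, h.iterate_eq _ (h.iterate_mem hb m),
      iterate_succ_apply']

/-- Summing `w` along the `f`-orbit is the same as summing, along the `G`-orbit, the sums of `w`
over the excursions. -/
theorem birkhoffSum_birkhoffSum {M : Type*} [AddCommMonoid M] (h : IsReturnSystem f Z G ι r D)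
    (w : α → M) {b : β} (hb : b ∈ D) (m : ℕ) :
    birkhoffSum f w (birkhoffSum G r m b) (ι b) =
      birkhoffSum G (fun b => birkhoffSum f w (r b) (ι b)) m b := by
  induction m with
  | zero => simp
  | succ m ih =>
    rw [birkhoffSum_succ G r, birkhoffSum_add, ih, h.iterate_birkhoffSum hb, birkhoffSum_succ]

/-- Every time lies in some excursion: it is a return time of `b` plus less than the next one. -/
theorem exists_eq_birkhoffSum_add (h : IsReturnSystem f Z G ι r D) {b : β} (hb : b ∈ D) (n : ℕ) :
    ∃ m j, j < r (G^[m] b) ∧ n = birkhoffSum G r m b + j := by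
  induction n with
  | zero => exact ⟨0, 0, h.pos b hb, by simp⟩
  | succ n ih =>
    obtain ⟨m, j, hj, rfl⟩ := ih
    by_cases hj' : j + 1 < r (G^[m] b)
    · exact ⟨m, j + 1, hj', by ring⟩
    · refine ⟨m + 1, 0, h.pos _ (h.iterate_mem hb _), ?_⟩
      rw [birkhoffSum_succ]
      omega

/-- A point of `Z` comes back to itself only at the end of an excursion, after which `G` has come
back to itself too. -/
theorem exists_of_iterate_eq (h : IsReturnSystem f Z G ι r D) {b : β} (hb : b ∈ D) {n : ℕ}
    (hn : f^[n] (ι b) = ι b) : ∃ m, n = birkhoffSum G r m b ∧ G^[m] b = b := by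
  obtain ⟨m, j, hj, rfl⟩ := h.exists_eq_birkhoffSum_add hb n
  have hD := h.iterate_mem hb m
  rw [add_comm, iterate_add_apply, h.iterate_birkhoffSum hb] at hn
  rcases Nat.eq_zero_or_pos j with rfl | hj0
  · exact ⟨m, rfl, h.injOn hD hb hn⟩
  · exact absurd (hn ▸ h.mem b hb) (h.notMem _ hD j hj0 hj)

/-- The period upstairs is the sum of the return times over one period downstairs. -/
theorem minimalPeriod_eq (h : IsReturnSystem f Z G ι r D) {b : β} (hb : b ∈ D)
    (hper : b ∈ periodicPts G) :
    minimalPeriod f (ι b) = birkhoffSum G r (minimalPeriod G b) b := by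
  have hN := minimalPeriod_pos_of_mem_periodicPts hper
  have hS : 0 < birkhoffSum G r (minimalPeriod G b) b :=
    calc 0 < birkhoffSum G r 1 b := by simpa using h.pos b hb
      _ ≤ _ := birkhoffSum_mono G r b hN
  have hfix : IsPeriodicPt f (birkhoffSum G r (minimalPeriod G b) b) (ι b) := by
    change f^[_] _ = _
    rw [h.iterate_birkhoffSum hb, iterate_minimalPeriod]
  refine le_antisymm (hfix.minimalPeriod_le hS) ?_
  obtain ⟨m, hm, hmb⟩ := h.exists_of_iterate_eq hb (iterate_minimalPeriod (f := f) (x := ι b))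
  rw [hm]
  have hm0 : 0 < m := by
    rcases Nat.eq_zero_or_pos m with rfl | h0
    · have := hfix.minimalPeriod_pos hS
      simp at hm
      omega
    · exact h0
  exact birkhoffSum_mono G r b (IsPeriodicPt.minimalPeriod_le hm0 hmb)

end IsReturnSystem

/-! ### The model: a piecewise rotation of a golden triangle -/

/-- Bounds that decide all the inequalities between elements of `ℤ[φ]` that occur below. -/
theorem goldenRatio_bounds : 1.618 < φ ∧ φ < 1.6181 := by
  have h := Real.goldenRatio_sq
  have h0 := Real.goldenRatio_pos
  constructor <;> nlinarith

/-- The open isosceles triangle with apex angle `π / 5`, in oblique coordinates `(u, v)` that are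
proportional to the distances from its two long sides; the apex is the origin. -/
def tip : Set (ℝ × ℝ) := {q | 0 < q.1 ∧ 0 < q.2 ∧ q.1 + q.2 < φ - 1}

/-- The part of the tip far from the apex, on which `tipMap` acts as a rotation by `3π / 5`. -/
def tipA : Set (ℝ × ℝ) := {q | q ∈ tip ∧ 2 - φ < φ * q.1 + q.2}

/-- The part of the tip near the apex, on which `tipMap` acts as a rotation by `4π / 5`. -/
def tipB : Set (ℝ × ℝ) := {q | q ∈ tip ∧ φ * q.1 + q.2 < 2 - φ}

open Classical in
/-- The map that the digital filter map and, up to a rotation of the pentagon, the tangent map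
induce on the tip by first return. Only its values on `tipA` and `tipB` matter; the definition
extends it to the plane. -/
def tipMap (q : ℝ × ℝ) : ℝ × ℝ :=
  if 2 - φ < φ * q.1 + q.2 then (1 - φ * q.1 - φ * q.2, φ * q.1 + q.2 + φ - 2)
  else (2 - φ - φ * q.1 - q.2, q.1)

open Classical in
/-- The weight that is `x` on the far part and `y` on the near part of the tip. -/
def tipWeight {M : Type*} (x y : M) (q : ℝ × ℝ) : M :=
  if 2 - φ < φ * q.1 + q.2 then x else y

section
variable {M : Type*} {x y : M} {q : ℝ × ℝ}

theorem tipMap_of_mem_tipA (h : q ∈ tipA) :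
    tipMap q = (1 - φ * q.1 - φ * q.2, φ * q.1 + q.2 + φ - 2) := if_pos h.2

theorem tipMap_of_mem_tipB (h : q ∈ tipB) : tipMap q = (2 - φ - φ * q.1 - q.2, q.1) :=
  if_neg h.2.not_gt

theorem tipWeight_of_mem_tipA (h : q ∈ tipA) : tipWeight x y q = x := if_pos h.2

theorem tipWeight_of_mem_tipB (h : q ∈ tipB) : tipWeight x y q = y := if_neg h.2.not_gt

end

/-- The points of the tip whose orbits under `tipMap` are defined forever: they never leave the two
open pieces. -/
def tipDomain : Set (ℝ × ℝ) := {q | ∀ n, tipMap^[n] q ∈ tipA ∪ tipB}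

theorem mapsTo_tipDomain : Set.MapsTo tipMap tipDomain tipDomain := fun q hq n => by
  simpa only [iterate_succ_apply] using hq (n + 1)

theorem mem_union_of_mem_tipDomain {q : ℝ × ℝ} (hq : q ∈ tipDomain) : q ∈ tipA ∪ tipB := hq 0

theorem tipDomain_subset_tip : tipDomain ⊆ tip := fun _ hq => (hq 0).elim And.left And.left

/-! ### Renormalization of the model -/

/-- The similarity from the tip onto the tip of the next generation: the homothety of ratio
`φ⁻³ = 2 φ - 3` towards the apex, followed by the reflection in the axis of the tip. -/
def tipScale (q : ℝ × ℝ) : ℝ × ℝ := ((2 * φ - 3) * q.2, (2 * φ - 3) * q.1)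

/-- The image of the tip under `tipScale`; the bound is `(2 φ - 3) (φ - 1) = 5 - 3 φ = φ⁻⁴`. -/
def smallTip : Set (ℝ × ℝ) := {q | 0 < q.1 ∧ 0 < q.2 ∧ q.1 + q.2 < 5 - 3 * φ}

theorem tipScale_injective : Injective tipScale := by
  have h := goldenRatio_bounds
  have h0 : 2 * φ - 3 ≠ 0 := by linarith
  rintro ⟨a, b⟩ ⟨c, d⟩ hq
  simp only [tipScale, Prod.mk.injEq, mul_right_inj' h0] at hq
  rw [hq.1, hq.2]

theorem tipScale_mem_smallTip {q : ℝ × ℝ} (hq : q ∈ tip) : tipScale q ∈ smallTip := by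
  obtain ⟨h1, h2, h3⟩ := hq
  have h := goldenRatio_bounds
  have h0 : 0 < 2 * φ - 3 := by linarith
  refine ⟨mul_pos h0 h2, mul_pos h0 h1, ?_⟩
  have := mul_lt_mul_of_pos_left h3 h0
  simp only [tipScale]
  linear_combination this + 2 * Real.goldenRatio_sq

/-- The multiples by small elements of `ℤ[φ]` of a positive real. Linear arithmetic over `ℚ` with
these finds the consequences that need coefficients in `ℚ(φ)`. -/
theorem goldenRatio_multiples_pos {x : ℝ} (hx : 0 < x) :
    0 < φ * x ∧ 0 < 2 * x - φ * x ∧ 0 < 2 * (φ * x) - 3 * x ∧ 0 < 5 * x - 3 * (φ * x) ∧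
      0 < 5 * (φ * x) - 8 * x := by
  have h := goldenRatio_bounds
  refine ⟨?_, ?_, ?_, ?_, ?_⟩ <;> nlinarith

theorem notMem_smallTip {q : ℝ × ℝ} (h : 5 - 3 * φ ≤ q.1 + q.2) : q ∉ smallTip :=
  fun hq => hq.2.2.not_ge h

/-- The beginning of the excursions from the small tip, the same on both of its pieces: one visit to
`tipB` and then three visits to `tipA`. -/
theorem tipMap_excursion_start {u v : ℝ} (hq : (u, v) ∈ tip) :
    tipScale (u, v) ∈ tipB ∧ ∃ q₁ ∈ tipA \ smallTip, ∃ q₂ ∈ tipA \ smallTip, ∃ q₃ ∈ tipA \ smallTip,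
      tipMap (tipScale (u, v)) = q₁ ∧ tipMap q₁ = q₂ ∧ tipMap q₂ = q₃ ∧
      tipMap q₃ =
        ((φ - 2) * (u + v) + (2 * φ - 3), (2 * φ - 3) * u + (2 - φ) * v + (5 * φ - 8)) := by
  obtain ⟨h1, h2, h3⟩ := hq
  simp only at h1 h2 h3
  obtain ⟨hφ1, hφ2⟩ := goldenRatio_bounds
  have hφ := Real.goldenRatio_sq
  have hu : φ ^ 2 * u = φ * u + u := by rw [hφ]; ring
  have hv : φ ^ 2 * v = φ * v + v := by rw [hφ]; ring
  obtain ⟨a1, a2, a3, a4, a5⟩ := goldenRatio_multiples_pos h1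
  obtain ⟨b1, b2, b3, b4, b5⟩ := goldenRatio_multiples_pos h2
  obtain ⟨c1, c2, c3, c4, c5⟩ := goldenRatio_multiples_pos (sub_pos.2 h3)
  have m0 : tipScale (u, v) ∈ tipB := by
    refine ⟨⟨?_, ?_, ?_⟩, ?_⟩ <;> simp only [tipScale] <;> linarith
  have m1 : ((3 - 2 * φ) * u + (φ - 2) * v + (2 - φ), (2 * φ - 3) * v) ∈ tipA \ smallTip := by
    refine ⟨⟨⟨?_, ?_, ?_⟩, ?_⟩, notMem_smallTip ?_⟩ <;> simp only <;> linarith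
  have m2 : ((2 - φ) * u + (2 * φ - 3) * v + (2 - φ), (φ - 2) * (u + v) + (2 * φ - 3))
      ∈ tipA \ smallTip := by
    refine ⟨⟨⟨?_, ?_, ?_⟩, ?_⟩, notMem_smallTip ?_⟩ <;> simp only <;> linarith
  have m3 : ((2 * φ - 3) * v, (2 * φ - 3) * u + (4 * φ - 6)) ∈ tipA \ smallTip := by
    refine ⟨⟨⟨?_, ?_, ?_⟩, ?_⟩, notMem_smallTip ?_⟩ <;> simp only <;> linarith
  refine ⟨m0, _, m1, _, m2, _, m3, ?_, ?_, ?_, ?_⟩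
  · rw [tipMap_of_mem_tipB m0]
    exact Prod.ext (by simp only [tipScale]; linarith) rfl
  · rw [tipMap_of_mem_tipA m1.1]
    refine Prod.ext ?_ ?_ <;> simp only <;> linarith
  · rw [tipMap_of_mem_tipA m2.1]
    refine Prod.ext ?_ ?_ <;> simp only <;> linarith
  · rw [tipMap_of_mem_tipA m3.1]
    refine Prod.ext ?_ ?_ <;> simp only <;> linarith

/-- An excursion from the image of `tipA` ends with a second visit to `tipB`. -/
theorem tipMap_excursion_end_of_mem_tipA {u v : ℝ} (hq : (u, v) ∈ tipA) :
    ((φ - 2) * (u + v) + (2 * φ - 3), (2 * φ - 3) * u + (2 - φ) * v + (5 * φ - 8))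
      ∈ tipB \ smallTip ∧
    tipMap ((φ - 2) * (u + v) + (2 * φ - 3), (2 * φ - 3) * u + (2 - φ) * v + (5 * φ - 8)) =
      tipScale (tipMap (u, v)) := by
  rw [tipMap_of_mem_tipA hq]
  obtain ⟨⟨h1, h2, h3⟩, h4⟩ := hq
  simp only at h1 h2 h3 h4
  obtain ⟨hφ1, hφ2⟩ := goldenRatio_bounds
  have hφ := Real.goldenRatio_sq
  have hu : φ ^ 2 * u = φ * u + u := by rw [hφ]; ring
  have hv : φ ^ 2 * v = φ * v + v := by rw [hφ]; ring
  obtain ⟨a1, a2, a3, a4, a5⟩ := goldenRatio_multiples_pos h1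
  obtain ⟨b1, b2, b3, b4, b5⟩ := goldenRatio_multiples_pos h2
  obtain ⟨c1, c2, c3, c4, c5⟩ := goldenRatio_multiples_pos (sub_pos.2 h3)
  obtain ⟨d1, d2, d3, d4, d5⟩ := goldenRatio_multiples_pos (sub_pos.2 h4)
  have m : ((φ - 2) * (u + v) + (2 * φ - 3), (2 * φ - 3) * u + (2 - φ) * v + (5 * φ - 8))
      ∈ tipB \ smallTip := by
    refine ⟨⟨⟨?_, ?_, ?_⟩, ?_⟩, notMem_smallTip ?_⟩ <;> simp only <;> linarith
  refine ⟨m, ?_⟩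
  rw [tipMap_of_mem_tipB m.1]
  refine Prod.ext ?_ ?_ <;> simp only [tipScale] <;> linarith

/-- An excursion from the image of `tipB` ends with three more visits to `tipA` and a second visit
to `tipB`. -/
theorem tipMap_excursion_end_of_mem_tipB {u v : ℝ} (hq : (u, v) ∈ tipB) :
    ∃ q₄ ∈ tipA \ smallTip, ∃ q₅ ∈ tipA \ smallTip, ∃ q₆ ∈ tipA \ smallTip,
      ∃ q₇ ∈ tipB \ smallTip,
      q₄ = ((φ - 2) * (u + v) + (2 * φ - 3), (2 * φ - 3) * u + (2 - φ) * v + (5 * φ - 8)) ∧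
      tipMap q₄ = q₅ ∧ tipMap q₅ = q₆ ∧ tipMap q₆ = q₇ ∧ tipMap q₇ = tipScale (tipMap (u, v)) := by
  rw [tipMap_of_mem_tipB hq]
  obtain ⟨⟨h1, h2, h3⟩, h4⟩ := hq
  simp only at h1 h2 h3 h4
  obtain ⟨hφ1, hφ2⟩ := goldenRatio_bounds
  have hφ := Real.goldenRatio_sq
  have hu : φ ^ 2 * u = φ * u + u := by rw [hφ]; ring
  have hv : φ ^ 2 * v = φ * v + v := by rw [hφ]; ring
  obtain ⟨a1, a2, a3, a4, a5⟩ := goldenRatio_multiples_pos h1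
  obtain ⟨b1, b2, b3, b4, b5⟩ := goldenRatio_multiples_pos h2
  obtain ⟨d1, d2, d3, d4, d5⟩ := goldenRatio_multiples_pos (sub_pos.2 h4)
  have m4 : ((φ - 2) * (u + v) + (2 * φ - 3), (2 * φ - 3) * u + (2 - φ) * v + (5 * φ - 8))
      ∈ tipA \ smallTip := by
    refine ⟨⟨⟨?_, ?_, ?_⟩, ?_⟩, notMem_smallTip ?_⟩ <;> simp only <;> linarith
  have m5 : ((2 * φ - 3) * u + (4 * φ - 6), (φ - 2) * u + (3 - 2 * φ) * v + (5 * φ - 8))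
      ∈ tipA \ smallTip := by
    refine ⟨⟨⟨?_, ?_, ?_⟩, ?_⟩, notMem_smallTip ?_⟩ <;> simp only <;> linarith
  have m6 : ((2 * φ - 3) * u + (2 - φ) * v + (5 * φ - 8), (3 - 2 * φ) * v + (4 * φ - 6))
      ∈ tipA \ smallTip := by
    refine ⟨⟨⟨?_, ?_, ?_⟩, ?_⟩, notMem_smallTip ?_⟩ <;> simp only <;> linarith
  have m7 : ((φ - 2) * u + (3 - 2 * φ) * v + (5 * φ - 8), (2 - φ) * (u + v) + (2 * φ - 3))
      ∈ tipB \ smallTip := by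
    refine ⟨⟨⟨?_, ?_, ?_⟩, ?_⟩, notMem_smallTip ?_⟩ <;> simp only <;> linarith
  refine ⟨_, m4, _, m5, _, m6, _, m7, rfl, ?_, ?_, ?_, ?_⟩
  · rw [tipMap_of_mem_tipA m4.1]
    refine Prod.ext ?_ ?_ <;> simp only <;> linarith
  · rw [tipMap_of_mem_tipA m5.1]
    refine Prod.ext ?_ ?_ <;> simp only <;> linarith
  · rw [tipMap_of_mem_tipA m6.1]
    refine Prod.ext ?_ ?_ <;> simp only <;> linarith
  · rw [tipMap_of_mem_tipB m7.1]
    refine Prod.ext ?_ ?_ <;> simp only [tipScale] <;> linarith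

/-- `tipMap` is conjugate, by `tipScale`, to its own first-return map on the small tip. -/
theorem isReturnSystem_tipScale :
    IsReturnSystem tipMap smallTip tipMap tipScale (tipWeight 5 8) tipDomain where
  mapsTo := mapsTo_tipDomain
  injOn := tipScale_injective.injOn
  pos q _ := by unfold tipWeight; split_ifs <;> norm_num
  mem q hq := tipScale_mem_smallTip (tipDomain_subset_tip hq)
  iterate_eq := by
    rintro ⟨u, v⟩ hq
    obtain ⟨-, q₁, -, q₂, -, q₃, -, e₀, e₁, e₂, e₃⟩ :=
      tipMap_excursion_start (tipDomain_subset_tip hq)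
    rcases mem_union_of_mem_tipDomain hq with h | h
    · obtain ⟨-, e₄⟩ := tipMap_excursion_end_of_mem_tipA h
      rw [tipWeight_of_mem_tipA h]
      simp only [iterate_succ_apply, iterate_zero_apply, e₀, e₁, e₂, e₃, e₄]
    · obtain ⟨q₄, -, q₅, -, q₆, -, q₇, -, rfl, e₄, e₅, e₆, e₇⟩ :=
        tipMap_excursion_end_of_mem_tipB h
      rw [tipWeight_of_mem_tipB h]
      simp only [iterate_succ_apply, iterate_zero_apply, e₀, e₁, e₂, e₃, e₄, e₅, e₆, e₇]
  notMem := by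
    rintro ⟨u, v⟩ hq j hj hj'
    obtain ⟨-, q₁, m₁, q₂, m₂, q₃, m₃, e₀, e₁, e₂, e₃⟩ :=
      tipMap_excursion_start (tipDomain_subset_tip hq)
    rcases mem_union_of_mem_tipDomain hq with h | h
    · obtain ⟨m₄, -⟩ := tipMap_excursion_end_of_mem_tipA h
      rw [tipWeight_of_mem_tipA h] at hj'
      interval_cases j <;>
        simp only [iterate_succ_apply, iterate_zero_apply, e₀, e₁, e₂, e₃] <;>
        first | exact m₁.2 | exact m₂.2 | exact m₃.2 | exact m₄.2
    · obtain ⟨q₄, m₄, q₅, m₅, q₆, m₆, q₇, m₇, rfl, e₄, e₅, e₆, -⟩ :=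
        tipMap_excursion_end_of_mem_tipB h
      rw [tipWeight_of_mem_tipB h] at hj'
      interval_cases j <;>
        simp only [iterate_succ_apply, iterate_zero_apply, e₀, e₁, e₂, e₃, e₄, e₅, e₆] <;>
        first
          | exact m₁.2 | exact m₂.2 | exact m₃.2 | exact m₄.2 | exact m₅.2 | exact m₆.2 | exact m₇.2

theorem tipMap_iterate_tipScale_mem {q : ℝ × ℝ} (hq : q ∈ tipDomain) {j : ℕ}
    (hj : j < tipWeight 5 8 q) : tipMap^[j] (tipScale q) ∈ tipA ∪ tipB := by
  obtain ⟨u, v⟩ := q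
  obtain ⟨m₀, q₁, m₁, q₂, m₂, q₃, m₃, e₀, e₁, e₂, e₃⟩ :=
    tipMap_excursion_start (tipDomain_subset_tip hq)
  rcases mem_union_of_mem_tipDomain hq with h | h
  · obtain ⟨m₄, -⟩ := tipMap_excursion_end_of_mem_tipA h
    rw [tipWeight_of_mem_tipA h] at hj
    interval_cases j <;>
      simp only [iterate_succ_apply, iterate_zero_apply, e₀, e₁, e₂, e₃]
    exacts [.inr m₀, .inl m₁.1, .inl m₂.1, .inl m₃.1, .inr m₄.1]
  · obtain ⟨q₄, m₄, q₅, m₅, q₆, m₆, q₇, m₇, rfl, e₄, e₅, e₆, -⟩ :=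
      tipMap_excursion_end_of_mem_tipB h
    rw [tipWeight_of_mem_tipB h] at hj
    interval_cases j <;>
      simp only [iterate_succ_apply, iterate_zero_apply, e₀, e₁, e₂, e₃, e₄, e₅, e₆]
    exacts [.inr m₀, .inl m₁.1, .inl m₂.1, .inl m₃.1, .inl m₄.1, .inl m₅.1, .inl m₆.1, .inr m₇.1]

/-- The substitution rule: an excursion from the image of `tipA` visits `tipA` three times and
`tipB` twice, one from the image of `tipB` visits them six times and twice. -/
theorem birkhoffSum_tipWeight_tipScale (x y : ℕ) {q : ℝ × ℝ} (hq : q ∈ tipDomain) :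
    birkhoffSum tipMap (tipWeight x y) (tipWeight 5 8 q) (tipScale q) =
      tipWeight (3 * x + 2 * y) (6 * x + 2 * y) q := by
  obtain ⟨u, v⟩ := q
  obtain ⟨m₀, q₁, m₁, q₂, m₂, q₃, m₃, e₀, e₁, e₂, e₃⟩ :=
    tipMap_excursion_start (tipDomain_subset_tip hq)
  rcases mem_union_of_mem_tipDomain hq with h | h
  · obtain ⟨m₄, -⟩ := tipMap_excursion_end_of_mem_tipA h
    rw [tipWeight_of_mem_tipA h, tipWeight_of_mem_tipA h]
    simp only [birkhoffSum, Finset.sum_range_succ, Finset.sum_range_zero, iterate_succ_apply,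
      iterate_zero_apply, e₀, e₁, e₂, e₃, tipWeight_of_mem_tipB m₀, tipWeight_of_mem_tipA m₁.1,
      tipWeight_of_mem_tipA m₂.1, tipWeight_of_mem_tipA m₃.1, tipWeight_of_mem_tipB m₄.1]
    ring
  · obtain ⟨q₄, m₄, q₅, m₅, q₆, m₆, q₇, m₇, rfl, e₄, e₅, e₆, -⟩ :=
      tipMap_excursion_end_of_mem_tipB h
    rw [tipWeight_of_mem_tipB h, tipWeight_of_mem_tipB h]
    simp only [birkhoffSum, Finset.sum_range_succ, Finset.sum_range_zero, iterate_succ_apply,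
      iterate_zero_apply, e₀, e₁, e₂, e₃, e₄, e₅, e₆, tipWeight_of_mem_tipB m₀,
      tipWeight_of_mem_tipA m₁.1, tipWeight_of_mem_tipA m₂.1, tipWeight_of_mem_tipA m₃.1,
      tipWeight_of_mem_tipA m₄.1, tipWeight_of_mem_tipA m₅.1, tipWeight_of_mem_tipA m₆.1,
      tipWeight_of_mem_tipB m₇.1]
    ring

theorem tipScale_mem_tipDomain {q : ℝ × ℝ} (hq : q ∈ tipDomain) : tipScale q ∈ tipDomain := by
  intro n
  obtain ⟨m, j, hj, rfl⟩ := isReturnSystem_tipScale.exists_eq_birkhoffSum_add hq n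
  rw [add_comm, iterate_add_apply, isReturnSystem_tipScale.iterate_birkhoffSum hq]
  exact tipMap_iterate_tipScale_mem (isReturnSystem_tipScale.iterate_mem hq m) hj

/-- Renormalization carries a periodic orbit to a periodic orbit, and transforms the sums of weights
over a period by the substitution rule. -/
theorem birkhoffSum_minimalPeriod_tipScale {q : ℝ × ℝ} (hq : q ∈ tipDomain)
    (hper : q ∈ periodicPts tipMap) (x y : ℕ) :
    birkhoffSum tipMap (tipWeight x y) (minimalPeriod tipMap (tipScale q)) (tipScale q) =
      birkhoffSum tipMap (tipWeight (3 * x + 2 * y) (6 * x + 2 * y))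
        (minimalPeriod tipMap q) q := by
  rw [isReturnSystem_tipScale.minimalPeriod_eq hq hper,
    isReturnSystem_tipScale.birkhoffSum_birkhoffSum _ hq]
  exact Finset.sum_congr rfl fun i _ =>
    birkhoffSum_tipWeight_tipScale x y (isReturnSystem_tipScale.iterate_mem hq i)

/-! ### The periodic orbits of the generations in the model -/

/-- The centre of the generation-`k` decagon in the coordinates of the tip. -/
def tipCenter (k : ℕ) : ℝ × ℝ := ((2 * φ - 3) ^ k, (2 * φ - 3) ^ k)

theorem tipScale_tipCenter (k : ℕ) : tipScale (tipCenter k) = tipCenter (k + 1) := by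
  simp only [tipScale, tipCenter, pow_succ']

/-- The numbers of visits to `tipA` and to `tipB` in one period of the centre of generation
`k + 1`. -/
def tipVisits : ℕ → ℕ × ℕ
  | 0 => (1, 0)
  | k + 1 => (3 * (tipVisits k).1 + 6 * (tipVisits k).2, 2 * (tipVisits k).1 + 2 * (tipVisits k).2)

theorem tipCenter_one_mem_tipA : tipCenter 1 ∈ tipA := by
  have hφ := Real.goldenRatio_sq
  obtain ⟨hφ1, hφ2⟩ := goldenRatio_bounds
  refine ⟨⟨?_, ?_, ?_⟩, ?_⟩ <;> simp only [tipCenter, pow_one] <;> linarith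

theorem isFixedPt_tipCenter_one : IsFixedPt tipMap (tipCenter 1) := by
  have hφ := Real.goldenRatio_sq
  rw [IsFixedPt, tipMap_of_mem_tipA tipCenter_one_mem_tipA]
  refine Prod.ext ?_ ?_ <;> simp only [tipCenter, pow_one] <;> linarith

theorem tipCenter_mem (k : ℕ) :
    tipCenter (k + 1) ∈ tipDomain ∧ tipCenter (k + 1) ∈ periodicPts tipMap := by
  induction k with
  | zero =>
    refine ⟨fun n => ?_, mk_mem_periodicPts one_pos isFixedPt_tipCenter_one⟩
    rw [zero_add, isFixedPt_tipCenter_one.iterate n]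
    exact .inl tipCenter_one_mem_tipA
  | succ k ih =>
    rw [← tipScale_tipCenter]
    refine ⟨tipScale_mem_tipDomain ih.1, ?_⟩
    have hS := isReturnSystem_tipScale.minimalPeriod_eq ih.1 ih.2
    rw [← minimalPeriod_pos_iff_mem_periodicPts, hS]
    exact Finset.sum_pos (fun i _ => isReturnSystem_tipScale.pos _
      (isReturnSystem_tipScale.iterate_mem ih.1 i))
      (Finset.nonempty_range_iff.2 (minimalPeriod_pos_of_mem_periodicPts ih.2).ne')

theorem birkhoffSum_tipCenter (k x y : ℕ) :
    birkhoffSum tipMap (tipWeight x y) (minimalPeriod tipMap (tipCenter (k + 1)))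
      (tipCenter (k + 1)) = (tipVisits k).1 * x + (tipVisits k).2 * y := by
  induction k generalizing x y with
  | zero =>
    rw [zero_add, minimalPeriod_eq_one_iff_isFixedPt.2 isFixedPt_tipCenter_one, birkhoffSum_one,
      tipWeight_of_mem_tipA tipCenter_one_mem_tipA]
    simp [tipVisits]
  | succ k ih =>
    rw [← tipScale_tipCenter, birkhoffSum_minimalPeriod_tipScale (tipCenter_mem k).1
      (tipCenter_mem k).2, ih]
    simp only [tipVisits]
    ring

theorem two_mul_tipVisits_sub (k : ℕ) :
    2 * ((tipVisits k).2 : ℤ) - (tipVisits k).1 = (-1) ^ (k + 1) := by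
  induction k with
  | zero => simp [tipVisits]
  | succ k ih =>
    rw [pow_succ, ← ih]
    simp only [tipVisits]
    push_cast
    ring

theorem seven_mul_tipVisits_add (k : ℕ) :
    7 * (((tipVisits k).1 : ℤ) + 2 * (tipVisits k).2) = 8 * 6 ^ k + (-1) ^ (k + 1) := by
  induction k with
  | zero => simp [tipVisits]
  | succ k ih =>
    have h := two_mul_tipVisits_sub k
    rw [pow_succ, pow_succ (-1 : ℤ)]
    simp only [tipVisits]
    push_cast
    linear_combination 6 * ih - 7 * h

/-- The arm in which the orbit of a centre returns after one period of the model is not the initial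
one: the total shift, `1` for each visit to `tipA` and `3` for each visit to `tipB`, alternates in
sign modulo `5` along the generations. -/
theorem not_five_dvd_tipVisits (k : ℕ) : ¬ 5 ∣ (tipVisits k).1 + (tipVisits k).2 * 3 := by
  induction k with
  | zero => simp [tipVisits]
  | succ k ih =>
    simp only [tipVisits]
    omega

/-! ### Coordinates in the plane of the pentagon -/

theorem cos_pi_div_five_eq : Real.cos (Real.pi / 5) = φ / 2 := by
  rw [Real.cos_pi_div_five, Real.goldenRatio]
  ring

theorem sin_pi_div_five_pos : 0 < Real.sin (Real.pi / 5) :=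
  Real.sin_pos_of_pos_of_lt_pi (by positivity) (by linarith [Real.pi_pos])

theorem sin_pi_div_five_sq : Real.sin (Real.pi / 5) ^ 2 = (3 - φ) / 4 := by
  rw [Real.sin_sq, cos_pi_div_five_eq]
  linear_combination (-1 / 4) * Real.goldenRatio_sq

/-- The tip of the pentagram at `genStar`, parametrized by the oblique coordinates `(u, v)`: the
apex `(0, 0)` goes to `genStar` and `u = 0` is the line through the bottom edge of the pentagon. -/
def tipToPlane (q : ℝ × ℝ) : ℝ × ℝ :=
  (Real.sin (Real.pi / 5) * ((2 * φ + 1) * (q.1 - 1) + (2 * φ + 2) * q.2),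
    (1 + φ / 2) * q.1 - φ / 2)

theorem genStar_eq : genStar = tipToPlane 0 := by
  have hs := sin_pi_div_five_pos.ne'
  have hs2 := sin_pi_div_five_sq
  have hφ := Real.goldenRatio_sq
  refine Prod.ext ?_ ?_
  · simp only [genStar, tipToPlane, cos_pi_div_five_eq, Prod.fst_zero, Prod.snd_zero]
    generalize φ = t at *
    field_simp
    rw [hs2]
    linear_combination (-3) * hφ
  · simp only [genStar, tipToPlane, cos_pi_div_five_eq, Prod.fst_zero]
    ring

theorem genScale_eq : genScale = 2 * φ - 3 := by
  have h0 := Real.goldenRatio_pos.ne'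
  have hφ := Real.goldenRatio_sq
  rw [genScale, cos_pi_div_five_eq]
  generalize φ = t at *
  field_simp
  linear_combination (-2) * hφ

theorem dadZeroCenter_eq : dadZeroCenter = tipToPlane (1, 1) := by
  have h0 := Real.goldenRatio_pos.ne'
  have hφ := Real.goldenRatio_sq
  rw [dadZeroCenter, genStar_eq, cos_pi_div_five_eq]
  refine Prod.ext ?_ ?_
  · simp only [tipToPlane, Prod.smul_fst, Prod.fst_neg, Prod.fst_zero, Prod.snd_zero, smul_eq_mul]
    generalize φ = t at *
    field_simp
    linear_combination (-2 * Real.sin (Real.pi / 5)) * hφ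
  · simp only [tipToPlane, Prod.smul_snd, Prod.snd_neg, Prod.fst_zero, smul_eq_mul]
    field_simp
    ring

theorem dad_center_eq (k : ℕ) : (dad k).center = tipToPlane (tipCenter k) := by
  simp only [dad, genScale_eq, dadZeroCenter_eq, genStar_eq, tipCenter]
  refine Prod.ext ?_ ?_ <;>
    simp only [tipToPlane, Prod.smul_fst, Prod.smul_snd, Prod.fst_add, Prod.snd_add, Prod.fst_sub,
      Prod.snd_sub, Prod.fst_zero, Prod.snd_zero, smul_eq_mul] <;>
    ring

/-! ### The digital filter map as a tower over the model -/

/-- The tip in the square on which the digital filter map acts; its apex is the corner `(-1, 1)`. -/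
def tipToDf (q : ℝ × ℝ) : ℝ × ℝ := (q.1 - 1, 1 - q.2)

theorem tsToDf_cDad (k : ℕ) : tsToDf (2 * Real.pi / 10) (cDad k) = tipToDf (tipCenter k) := by
  have hs2 := sin_pi_div_five_sq
  have hφ := Real.goldenRatio_sq
  have h0 : 2 + φ ≠ 0 := by linarith [Real.goldenRatio_pos]
  have hθ : 2 * Real.pi / 10 = Real.pi / 5 := by ring
  rw [hθ, cDad, kTo2k, cMom, rMom, dadHeight, dad_center_eq, dad_center_eq, cos_pi_div_five_eq]
  refine Prod.ext ?_ ?_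
  · simp only [tsToDf, conjG, tipToPlane, tipToDf, tipCenter, Prod.snd_add, Prod.snd_neg,
      Prod.smul_snd, smul_eq_mul, pow_zero]
    field_simp
    ring
  · simp only [tsToDf, conjG, tipToPlane, tipToDf, tipCenter, Prod.snd_add, Prod.snd_neg,
      Prod.smul_snd, smul_eq_mul, pow_zero, Prod.fst_add, Prod.fst_neg, Prod.smul_fst,
      cos_pi_div_five_eq]
    generalize (2 * φ - 3) ^ k = x
    generalize Real.sin (Real.pi / 5) = s at *
    generalize φ = t at *
    field_simp
    rw [hs2]
    linear_combination 5 * (x - 1) * hφ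

theorem sawtooth_eq {z : ℝ} (n : ℤ) (h1 : 2 * n - 1 ≤ z) (h2 : z < 2 * n + 1) :
    sawtooth z = z - 2 * n := by
  have h : ⌊(z + 1) / 2⌋ = n := Int.floor_eq_iff.2 ⟨by linarith, by linarith⟩
  rw [sawtooth, h]
  ring

theorem digitalFilter_eq {x y : ℝ} (n : ℤ) (h1 : 2 * n - 1 ≤ -x + φ * y)
    (h2 : -x + φ * y < 2 * n + 1) :
    digitalFilter (2 * Real.pi / 10) (x, y) = (y, -x + φ * y - 2 * n) := by
  have hθ : 2 * Real.pi / 10 = Real.pi / 5 := by ring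
  have e : -x + 2 * (φ / 2) * y = -x + φ * y := by ring
  rw [digitalFilter, hθ, cos_pi_div_five_eq]
  simp only [e, sawtooth_eq n h1 h2]

/-- The beginning of the excursions of the digital filter map from the tip. -/
theorem digitalFilter_excursion {u v : ℝ} (hq : (u, v) ∈ tip) :
    digitalFilter (2 * Real.pi / 10) (tipToDf (u, v)) = (1 - v, φ - 1 - u - φ * v) ∧
    digitalFilter (2 * Real.pi / 10) (1 - v, φ - 1 - u - φ * v) =
      (φ - 1 - u - φ * v, -φ * (u + v)) := by
  obtain ⟨h1, h2, h3⟩ := hq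
  simp only at h1 h2 h3
  obtain ⟨hφ1, hφ2⟩ := goldenRatio_bounds
  have hφ := Real.goldenRatio_sq
  have hv : φ ^ 2 * v = φ * v + v := by rw [hφ]; ring
  obtain ⟨a1, a2, a3, a4, a5⟩ := goldenRatio_multiples_pos h1
  obtain ⟨b1, b2, b3, b4, b5⟩ := goldenRatio_multiples_pos h2
  obtain ⟨c1, c2, c3, c4, c5⟩ := goldenRatio_multiples_pos (sub_pos.2 h3)
  constructor
  · rw [tipToDf, digitalFilter_eq 1] <;> push_cast
    · exact Prod.ext rfl (by simp only; linarith)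
    · linarith
    · linarith
  · rw [digitalFilter_eq 0] <;> push_cast
    · exact Prod.ext rfl (by simp only; linarith)
    · linarith
    · linarith

theorem digitalFilter_excursion_of_mem_tipA {u v : ℝ} (hq : (u, v) ∈ tipA) :
    digitalFilter (2 * Real.pi / 10) (φ - 1 - u - φ * v, -φ * (u + v)) =
      tipToDf (tipMap (u, v)) := by
  rw [tipMap_of_mem_tipA hq]
  obtain ⟨⟨h1, h2, h3⟩, h4⟩ := hq
  simp only at h1 h2 h3 h4
  obtain ⟨hφ1, hφ2⟩ := goldenRatio_bounds
  have hφ := Real.goldenRatio_sq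
  have hu : φ ^ 2 * u = φ * u + u := by rw [hφ]; ring
  have hv : φ ^ 2 * v = φ * v + v := by rw [hφ]; ring
  obtain ⟨a1, a2, a3, a4, a5⟩ := goldenRatio_multiples_pos h1
  obtain ⟨b1, b2, b3, b4, b5⟩ := goldenRatio_multiples_pos h2
  obtain ⟨c1, c2, c3, c4, c5⟩ := goldenRatio_multiples_pos (sub_pos.2 h3)
  rw [digitalFilter_eq (-1)] <;> push_cast
  · refine Prod.ext ?_ ?_ <;> simp only [tipToDf] <;> linarith
  · linarith
  · linarith

theorem digitalFilter_excursion_of_mem_tipB {u v : ℝ} (hq : (u, v) ∈ tipB) :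
    digitalFilter (2 * Real.pi / 10) (φ - 1 - u - φ * v, -φ * (u + v)) =
      (-φ * (u + v), 1 - φ - φ * u - v) ∧
    digitalFilter (2 * Real.pi / 10) (-φ * (u + v), 1 - φ - φ * u - v) =
      tipToDf (tipMap (u, v)) := by
  rw [tipMap_of_mem_tipB hq]
  obtain ⟨⟨h1, h2, h3⟩, h4⟩ := hq
  simp only at h1 h2 h3 h4
  obtain ⟨hφ1, hφ2⟩ := goldenRatio_bounds
  have hφ := Real.goldenRatio_sq
  have hu : φ ^ 2 * u = φ * u + u := by rw [hφ]; ring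
  have hv : φ ^ 2 * v = φ * v + v := by rw [hφ]; ring
  obtain ⟨a1, a2, a3, a4, a5⟩ := goldenRatio_multiples_pos h1
  obtain ⟨b1, b2, b3, b4, b5⟩ := goldenRatio_multiples_pos h2
  obtain ⟨c1, c2, c3, c4, c5⟩ := goldenRatio_multiples_pos (sub_pos.2 h4)
  constructor
  · rw [digitalFilter_eq 0] <;> push_cast
    · exact Prod.ext rfl (by simp only; linarith)
    · linarith
    · linarith
  · rw [digitalFilter_eq (-1)] <;> push_cast
    · refine Prod.ext ?_ ?_ <;> simp only [tipToDf] <;> linarith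
    · linarith
    · linarith

/-- The return times of the digital filter map to the tip at the corner are `3` and `4`. -/
theorem isReturnSystem_tipToDf :
    IsReturnSystem (digitalFilter (2 * Real.pi / 10)) {p | (p.1 + 1, 1 - p.2) ∈ tip} tipMap tipToDf
      (tipWeight 3 4) tipDomain where
  mapsTo := mapsTo_tipDomain
  injOn := by
    rintro ⟨a, b⟩ - ⟨c, d⟩ - h
    simp only [tipToDf, Prod.mk.injEq] at h
    exact Prod.ext (by simpa using h.1) (by simpa using h.2)
  pos q _ := by unfold tipWeight; split_ifs <;> norm_num
  mem q hq := by simpa [tipToDf] using tipDomain_subset_tip hq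
  iterate_eq := by
    rintro ⟨u, v⟩ hq
    obtain ⟨e₀, e₁⟩ := digitalFilter_excursion (tipDomain_subset_tip hq)
    rcases mem_union_of_mem_tipDomain hq with h | h
    · have e₂ := digitalFilter_excursion_of_mem_tipA h
      rw [tipWeight_of_mem_tipA h]
      simp only [iterate_succ_apply, iterate_zero_apply, e₀, e₁, e₂]
    · obtain ⟨e₂, e₃⟩ := digitalFilter_excursion_of_mem_tipB h
      rw [tipWeight_of_mem_tipB h]
      simp only [iterate_succ_apply, iterate_zero_apply, e₀, e₁, e₂, e₃]
  notMem := by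
    rintro ⟨u, v⟩ hq j hj hj'
    obtain ⟨e₀, e₁⟩ := digitalFilter_excursion (tipDomain_subset_tip hq)
    obtain ⟨h1, h2, h3⟩ := tipDomain_subset_tip hq
    simp only at h1 h2 h3
    obtain ⟨hφ1, hφ2⟩ := goldenRatio_bounds
    have a1 := (goldenRatio_multiples_pos h1).1
    have b1 := (goldenRatio_multiples_pos h2).1
    -- The first intermediate point is too far to the right, the later ones are too low.
    have n₁ : (1 - v, φ - 1 - u - φ * v) ∉ {p : ℝ × ℝ | (p.1 + 1, 1 - p.2) ∈ tip} := by
      rintro ⟨-, h5, h6⟩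
      simp only at h5 h6
      linarith
    have n₂ : (φ - 1 - u - φ * v, -φ * (u + v)) ∉ {p : ℝ × ℝ | (p.1 + 1, 1 - p.2) ∈ tip} := by
      rintro ⟨h5, -, h6⟩
      simp only at h5 h6
      linarith
    have n₃ : (-φ * (u + v), 1 - φ - φ * u - v) ∉ {p : ℝ × ℝ | (p.1 + 1, 1 - p.2) ∈ tip} := by
      rintro ⟨h5, -, h6⟩
      simp only at h5 h6
      linarith
    rcases mem_union_of_mem_tipDomain hq with h | h
    · rw [tipWeight_of_mem_tipA h] at hj'
      interval_cases j <;> simp only [iterate_succ_apply, iterate_zero_apply, e₀, e₁] <;>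
        assumption
    · obtain ⟨e₂, -⟩ := digitalFilter_excursion_of_mem_tipB h
      rw [tipWeight_of_mem_tipB h] at hj'
      interval_cases j <;> simp only [iterate_succ_apply, iterate_zero_apply, e₀, e₁, e₂] <;>
        assumption

theorem dfPeriod_cDad (k : ℕ) :
    dfPeriod (2 * Real.pi / 10) (tsToDf (2 * Real.pi / 10) (cDad (k + 1))) =
      (tipVisits k).1 * 3 + (tipVisits k).2 * 4 := by
  obtain ⟨hD, hper⟩ := tipCenter_mem k
  rw [dfPeriod, tsToDf_cDad, isReturnSystem_tipToDf.minimalPeriod_eq hD hper, birkhoffSum_tipCenter]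

/-! ### The pentagon and its rotation -/

/-- The vertices of the pentagon, clockwise from the top, indexed by `ZMod 5` so that indices wrap
around. -/
def pentagonVertex : ZMod 5 → ℝ × ℝ :=
  ![(0, 1), (Real.sin (Real.pi / 5) * φ, (φ - 1) / 2), (Real.sin (Real.pi / 5) * 1, -(φ / 2)),
    (Real.sin (Real.pi / 5) * (-1), -(φ / 2)), (Real.sin (Real.pi / 5) * (-φ), (φ - 1) / 2)]

theorem mom_vertex_eq (j : ZMod 5) : mom.vertex j = pentagonVertex j := by
  have hφ := Real.goldenRatio_sq
  have hs : Real.sin (2 * Real.pi / 5) = Real.sin (Real.pi / 5) * φ := by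
    rw [show 2 * Real.pi / 5 = 2 * (Real.pi / 5) by ring, Real.sin_two_mul, cos_pi_div_five_eq]
    ring
  have hc : Real.cos (2 * Real.pi / 5) = (φ - 1) / 2 := by
    rw [show 2 * Real.pi / 5 = 2 * (Real.pi / 5) by ring, Real.cos_two_mul, cos_pi_div_five_eq]
    linear_combination hφ / 2
  have key : mom.vertex j = (Real.sin (2 * Real.pi * (j.val : ℝ) / 5),
      Real.cos (2 * Real.pi * (j.val : ℝ) / 5)) := by
    have e : mom.vertex j = (0 + 1 * Real.cos (Real.pi / 2 - 2 * Real.pi * (j.val : ℝ) / (5 : ℕ)),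
      0 + 1 * Real.sin (Real.pi / 2 - 2 * Real.pi * (j.val : ℝ) / (5 : ℕ))) := rfl
    rw [e, Real.cos_pi_div_two_sub, Real.sin_pi_div_two_sub]
    simp
  have h2 : 2 * Real.pi * 2 / 5 = Real.pi - Real.pi / 5 := by ring
  have h3 : 2 * Real.pi * 3 / 5 = Real.pi / 5 + Real.pi := by ring
  have h4 : 2 * Real.pi * 4 / 5 = 2 * Real.pi - 2 * Real.pi / 5 := by ring
  rw [key]
  fin_cases j
  · simp [pentagonVertex, ZMod.val]
  · simp [pentagonVertex, ZMod.val, hs, hc]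
  · simp [pentagonVertex, ZMod.val, h2, -Real.cos_pi_div_five, cos_pi_div_five_eq]
  · simp [pentagonVertex, ZMod.val, h3, Real.sin_add_pi, Real.cos_add_pi, -Real.cos_pi_div_five,
      cos_pi_div_five_eq]
  · simp [pentagonVertex, ZMod.val, h4, Real.sin_two_pi_sub, Real.cos_two_pi_sub, hs, hc]

/-- The clockwise rotation by `2π / 5` about the centre of the pentagon. -/
def rot (p : ℝ × ℝ) : ℝ × ℝ :=
  ((φ - 1) / 2 * p.1 + Real.sin (Real.pi / 5) * φ * p.2,
    -(Real.sin (Real.pi / 5) * φ) * p.1 + (φ - 1) / 2 * p.2)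

/-- The entries of the matrix of `rot` are a cosine and a sine. -/
theorem cos_sq_add_sin_sq_rot :
    ((φ - 1) / 2) ^ 2 + (Real.sin (Real.pi / 5) * φ) ^ 2 = 1 := by
  linear_combination φ ^ 2 * sin_pi_div_five_sq + (3 - φ) / 4 * Real.goldenRatio_sq

theorem rot_pentagonVertex (j : ZMod 5) : rot (pentagonVertex j) = pentagonVertex (j + 1) := by
  have hφ := Real.goldenRatio_sq
  have hs := sin_pi_div_five_sq
  fin_cases j
  · change rot (0, 1) = (Real.sin (Real.pi / 5) * φ, (φ - 1) / 2)
    exact Prod.ext (by simp only [rot]; ring) (by simp only [rot]; ring)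
  · change rot (Real.sin (Real.pi / 5) * φ, (φ - 1) / 2) = (Real.sin (Real.pi / 5) * 1, -(φ / 2))
    refine Prod.ext ?_ ?_ <;> simp only [rot]
    · linear_combination Real.sin (Real.pi / 5) * hφ
    · linear_combination -φ ^ 2 * hs + (φ - 1) / 4 * hφ
  · change rot (Real.sin (Real.pi / 5) * 1, -(φ / 2)) = (Real.sin (Real.pi / 5) * (-1), -(φ / 2))
    refine Prod.ext ?_ ?_ <;> simp only [rot]
    · linear_combination -Real.sin (Real.pi / 5) / 2 * hφ
    · linear_combination -φ * hs
  · change rot (Real.sin (Real.pi / 5) * (-1), -(φ / 2)) =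
      (Real.sin (Real.pi / 5) * (-φ), (φ - 1) / 2)
    refine Prod.ext ?_ ?_ <;> simp only [rot]
    · linear_combination -Real.sin (Real.pi / 5) / 2 * hφ
    · linear_combination φ * hs - 1 / 2 * hφ
  · change rot (Real.sin (Real.pi / 5) * (-φ), (φ - 1) / 2) = (0, 1)
    refine Prod.ext ?_ ?_ <;> simp only [rot]
    · ring
    · linear_combination cos_sq_add_sin_sq_rot

theorem rot_rot (p : ℝ × ℝ) : rot (rot p) =
    (-(φ / 2) * p.1 + Real.sin (Real.pi / 5) * p.2,
      -Real.sin (Real.pi / 5) * p.1 - φ / 2 * p.2) := by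
  have h : ((φ - 1) / 2) ^ 2 - (Real.sin (Real.pi / 5) * φ) ^ 2 = -(φ / 2) := by
    linear_combination -φ ^ 2 * sin_pi_div_five_sq + (φ - 1) / 4 * Real.goldenRatio_sq
  have h' : (φ - 1) * (Real.sin (Real.pi / 5) * φ) = Real.sin (Real.pi / 5) := by
    linear_combination Real.sin (Real.pi / 5) * Real.goldenRatio_sq
  refine Prod.ext ?_ ?_ <;> simp only [rot]
  · linear_combination p.1 * h + p.2 * h'
  · linear_combination p.2 * h - p.1 * h'

theorem rot_iterate_five (p : ℝ × ℝ) : rot^[5] p = p := by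
  have h := cos_sq_add_sin_sq_rot
  have h' : (φ / 2) ^ 2 - Real.sin (Real.pi / 5) ^ 2 = (φ - 1) / 2 := by
    linear_combination Real.goldenRatio_sq / 4 - sin_pi_div_five_sq
  simp only [iterate_succ_apply, iterate_zero_apply, rot_rot]
  refine Prod.ext ?_ ?_ <;> simp only [rot]
  · linear_combination p.1 * h +
      ((φ - 1) / 2 * p.1 + Real.sin (Real.pi / 5) * φ * p.2) * h'
  · linear_combination p.2 * h +
      ((φ - 1) / 2 * p.2 - Real.sin (Real.pi / 5) * φ * p.1) * h'

theorem rot_tangent (p c : ℝ × ℝ) : rot (-p + (2 : ℝ) • c) = -rot p + (2 : ℝ) • rot c := by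
  refine Prod.ext ?_ ?_ <;>
    simp only [rot, Prod.fst_add, Prod.snd_add, Prod.fst_neg, Prod.snd_neg, Prod.smul_fst,
      Prod.smul_snd, smul_eq_mul] <;>
    ring

theorem rot_dot (p q : ℝ × ℝ) :
    (rot p).1 * (rot q).1 + (rot p).2 * (rot q).2 = p.1 * q.1 + p.2 * q.2 := by
  simp only [rot]
  linear_combination (p.1 * q.1 + p.2 * q.2) * cos_sq_add_sin_sq_rot

theorem rot_cross (p q r : ℝ × ℝ) :
    ((rot q).1 - (rot p).1) * ((rot r).2 - (rot p).2) -
      ((rot q).2 - (rot p).2) * ((rot r).1 - (rot p).1) =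
    (q.1 - p.1) * (r.2 - p.2) - (q.2 - p.2) * (r.1 - p.1) := by
  simp only [rot]
  linear_combination ((q.1 - p.1) * (r.2 - p.2) - (q.2 - p.2) * (r.1 - p.1)) *
    cos_sq_add_sin_sq_rot

/-! ### The tangent map and its symmetry -/

/-- `IsContact` with the vertices indexed by `ZMod 5`, which is by definition `Fin mom.sides`. -/
theorem isContact_mom_iff {p c : ℝ × ℝ} : IsContact mom p c ↔ ∃ j : ZMod 5, c = pentagonVertex j ∧
    ∀ i : ZMod 5, i ≠ j → (c.1 - p.1) * ((pentagonVertex i).2 - p.2) -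
      (c.2 - p.2) * ((pentagonVertex i).1 - p.1) < 0 := by
  simp only [← mom_vertex_eq]
  exact Iff.rfl

/-- Of two vertices, each cannot be strictly to the right of the line through the other. -/
theorem IsContact.unique {P : RegularPolygon} {p c d : ℝ × ℝ} (hc : IsContact P p c)
    (hd : IsContact P p d) : c = d := by
  obtain ⟨i, rfl, hi⟩ := hc
  obtain ⟨j, rfl, hj⟩ := hd
  by_contra h
  have hij : j ≠ i := fun e => h (e ▸ rfl)
  linarith [hi j hij, hj i hij.symm]

theorem tangentMap_eq {P : RegularPolygon} {p c : ℝ × ℝ} (hc : IsContact P p c) :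
    tangentMap P p = some (-p + (2 : ℝ) • c) := by
  have h : ∃ c, IsContact P p c := ⟨c, hc⟩
  rw [tangentMap, dif_pos h, h.choose_spec.unique hc]

theorem IsContact.rot {p c : ℝ × ℝ} (h : IsContact mom p c) :
    IsContact mom (rot p) (rot c) := by
  rw [isContact_mom_iff] at h ⊢
  obtain ⟨j, rfl, hj⟩ := h
  refine ⟨j + 1, rot_pentagonVertex j, fun i hi => ?_⟩
  obtain ⟨i, rfl⟩ : ∃ i', i = i' + 1 := ⟨i - 1, by ring⟩
  rw [← rot_pentagonVertex i, rot_cross]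
  exact hj i fun e => hi (e ▸ rfl)

theorem tangentMap_rot_iterate {p c : ℝ × ℝ} (h : IsContact mom p c) (n : ℕ) :
    tangentMap mom (rot^[n] p) = some (rot^[n] (-p + (2 : ℝ) • c)) := by
  induction n generalizing p c with
  | zero => exact tangentMap_eq h
  | succ n ih => rw [iterate_succ_apply, iterate_succ_apply, ih h.rot, rot_tangent]

/-- The contact condition without the common factor `sin (π / 5)` of all first coordinates. -/
theorem isContact_mom_of {a b x y : ℝ} (j : ZMod 5)
    (hj : pentagonVertex j = (Real.sin (Real.pi / 5) * x, y))
    (h : ∀ i, i ≠ j → ∃ x' y', pentagonVertex i = (Real.sin (Real.pi / 5) * x', y') ∧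
      (x - a) * (y' - b) - (y - b) * (x' - a) < 0) :
    IsContact mom (Real.sin (Real.pi / 5) * a, b) (pentagonVertex j) := by
  refine isContact_mom_iff.2 ⟨j, rfl, fun i hi => ?_⟩
  obtain ⟨x', y', hi', hlt⟩ := h i hi
  rw [hi', hj]
  have := mul_neg_of_pos_of_neg sin_pi_div_five_pos hlt
  simp only
  linarith

theorem isContact_tip {q : ℝ × ℝ} (hq : q ∈ tip) :
    IsContact mom (tipToPlane q) (pentagonVertex 4) := by
  obtain ⟨u, v⟩ := q
  obtain ⟨h1, h2, h3⟩ := hq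
  simp only at h1 h2 h3
  obtain ⟨hφ1, hφ2⟩ := goldenRatio_bounds
  have hφ := Real.goldenRatio_sq
  have hu : φ ^ 2 * u = φ * u + u := by rw [hφ]; ring
  have hv : φ ^ 2 * v = φ * v + v := by rw [hφ]; ring
  obtain ⟨a1, a2, a3, a4, a5⟩ := goldenRatio_multiples_pos h1
  obtain ⟨b1, b2, b3, b4, b5⟩ := goldenRatio_multiples_pos h2
  obtain ⟨c1, c2, c3, c4, c5⟩ := goldenRatio_multiples_pos (sub_pos.2 h3)
  refine isContact_mom_of 4 rfl fun i hi => ?_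
  fin_cases i
  · exact ⟨0, 1, by simp [pentagonVertex], by linarith⟩
  · exact ⟨_, _, rfl, by linarith⟩
  · exact ⟨_, _, rfl, by linarith⟩
  · exact ⟨_, _, rfl, by linarith⟩
  · exact absurd rfl hi

/-- The image of the tip under the first step of the tangent map, which reflects it in the vertex
`4`. -/
theorem reflect_tipToPlane (u v : ℝ) : -tipToPlane (u, v) + (2 : ℝ) • pentagonVertex 4 =
    (Real.sin (Real.pi / 5) * (-((2 * φ + 1) * (u - 1) + (2 * φ + 2) * v) - 2 * φ),
      -((1 + φ / 2) * u - φ / 2) + (φ - 1)) := by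
  have e4 : pentagonVertex 4 = (Real.sin (Real.pi / 5) * (-φ), (φ - 1) / 2) := rfl
  rw [e4]
  refine Prod.ext ?_ ?_ <;>
    simp only [tipToPlane, Prod.fst_add, Prod.snd_add, Prod.fst_neg, Prod.snd_neg, Prod.smul_fst,
      Prod.smul_snd, smul_eq_mul] <;>
    ring

theorem isContact_tipB {q : ℝ × ℝ} (hq : q ∈ tipB) :
    IsContact mom (-tipToPlane q + (2 : ℝ) • pentagonVertex 4) (pentagonVertex 1) := by
  obtain ⟨u, v⟩ := q
  obtain ⟨⟨h1, h2, h3⟩, h4⟩ := hq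
  simp only at h1 h2 h3 h4
  obtain ⟨hφ1, hφ2⟩ := goldenRatio_bounds
  have hφ := Real.goldenRatio_sq
  have hu : φ ^ 2 * u = φ * u + u := by rw [hφ]; ring
  have hv : φ ^ 2 * v = φ * v + v := by rw [hφ]; ring
  obtain ⟨a1, a2, a3, a4, a5⟩ := goldenRatio_multiples_pos h1
  obtain ⟨b1, b2, b3, b4, b5⟩ := goldenRatio_multiples_pos h2
  obtain ⟨c1, c2, c3, c4, c5⟩ := goldenRatio_multiples_pos (sub_pos.2 h4)
  rw [reflect_tipToPlane]
  refine isContact_mom_of 1 rfl fun i hi => ?_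
  fin_cases i
  · exact ⟨0, 1, by simp [pentagonVertex], by linarith⟩
  · exact absurd rfl hi
  · exact ⟨_, _, rfl, by linarith⟩
  · exact ⟨_, _, rfl, by linarith⟩
  · exact ⟨_, _, rfl, by linarith⟩

/-! ### The tangent map as a tower over five copies of the model -/

/-- `IsBeyond j p`: the line through the edge opposite to the vertex `j` separates `p` from the
pentagon. -/
def IsBeyond (j : ZMod 5) (p : ℝ × ℝ) : Prop :=
  p.1 * (pentagonVertex j).1 + p.2 * (pentagonVertex j).2 < -(φ / 2)

theorem isBeyond_rot {j : ZMod 5} {p : ℝ × ℝ} : IsBeyond (j + 1) (rot p) ↔ IsBeyond j p := by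
  rw [IsBeyond, IsBeyond, ← rot_pentagonVertex, rot_dot]

theorem isBeyond_rot_iterate {j : ZMod 5} {p : ℝ × ℝ} (n : ℕ) :
    IsBeyond (j + n) (rot^[n] p) ↔ IsBeyond j p := by
  induction n with
  | zero => simp
  | succ n ih => rw [iterate_succ_apply', Nat.cast_succ, ← add_assoc, isBeyond_rot, ih]

/-- The sum that defines `IsBeyond`, with the factor `sin (π / 5) ^ 2` evaluated. -/
theorem isBeyond_iff {j : ZMod 5} {a b x y : ℝ}
    (hj : pentagonVertex j = (Real.sin (Real.pi / 5) * x, y)) :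
    IsBeyond j (Real.sin (Real.pi / 5) * a, b) ↔ (3 - φ) / 4 * (a * x) + b * y < -(φ / 2) := by
  rw [IsBeyond, hj, ← sin_pi_div_five_sq]
  ring_nf

theorem isBeyond_tipToPlane {q : ℝ × ℝ} (hq : q ∈ tip) (j : ZMod 5) :
    IsBeyond j (tipToPlane q) ↔ j = 1 := by
  obtain ⟨u, v⟩ := q
  obtain ⟨h1, h2, h3⟩ := hq
  simp only at h1 h2 h3
  obtain ⟨hφ1, hφ2⟩ := goldenRatio_bounds
  have hφ := Real.goldenRatio_sq
  have hφ3 : φ ^ 3 = 2 * φ + 1 := by linear_combination (φ + 1) * hφ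
  have hu : φ ^ 2 * u = φ * u + u := by rw [hφ]; ring
  have hv : φ ^ 2 * v = φ * v + v := by rw [hφ]; ring
  have hu3 : φ ^ 3 * u = 2 * (φ * u) + u := by rw [hφ3]; ring
  have hv3 : φ ^ 3 * v = 2 * (φ * v) + v := by rw [hφ3]; ring
  obtain ⟨a1, a2, a3, a4, a5⟩ := goldenRatio_multiples_pos h1
  obtain ⟨b1, b2, b3, b4, b5⟩ := goldenRatio_multiples_pos h2
  obtain ⟨c1, c2, c3, c4, c5⟩ := goldenRatio_multiples_pos (sub_pos.2 h3)
  have e0 : pentagonVertex 0 = (Real.sin (Real.pi / 5) * 0, 1) := by simp [pentagonVertex]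
  have h0 : ¬ IsBeyond 0 (tipToPlane (u, v)) := by
    rw [tipToPlane, isBeyond_iff e0, not_lt]
    linarith
  have h1 : IsBeyond 1 (tipToPlane (u, v)) := by
    rw [tipToPlane, isBeyond_iff (j := 1) rfl]
    linarith
  have h2 : ¬ IsBeyond 2 (tipToPlane (u, v)) := by
    rw [tipToPlane, isBeyond_iff (j := 2) rfl, not_lt]
    linarith
  have h3 : ¬ IsBeyond 3 (tipToPlane (u, v)) := by
    rw [tipToPlane, isBeyond_iff (j := 3) rfl, not_lt]
    linarith
  have h4 : ¬ IsBeyond 4 (tipToPlane (u, v)) := by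
    rw [tipToPlane, isBeyond_iff (j := 4) rfl, not_lt]
    linarith
  fin_cases j
  · exact iff_of_false h0 (by decide : (0 : ZMod 5) ≠ 1)
  · exact iff_of_true h1 rfl
  · exact iff_of_false h2 (by decide : (2 : ZMod 5) ≠ 1)
  · exact iff_of_false h3 (by decide : (3 : ZMod 5) ≠ 1)
  · exact iff_of_false h4 (by decide : (4 : ZMod 5) ≠ 1)

theorem isBeyond_rot_iterate_tipToPlane {q : ℝ × ℝ} (hq : q ∈ tip) (j : ZMod 5) (n : ℕ) :
    IsBeyond j (rot^[n] (tipToPlane q)) ↔ j = 1 + n := by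
  obtain ⟨j, rfl⟩ : ∃ j', j = j' + n := ⟨j - n, by ring⟩
  rw [isBeyond_rot_iterate, isBeyond_tipToPlane hq, add_left_inj]

/-- After one step from `tipB` a point is beyond two edges, hence in no tip of the pentagram. -/
theorem isBeyond_reflect_tipToPlane {q : ℝ × ℝ} (hq : q ∈ tipB) :
    IsBeyond 2 (-tipToPlane q + (2 : ℝ) • pentagonVertex 4) ∧
      IsBeyond 3 (-tipToPlane q + (2 : ℝ) • pentagonVertex 4) := by
  obtain ⟨u, v⟩ := q
  obtain ⟨⟨h1, h2, h3⟩, h4⟩ := hq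
  simp only at h1 h2 h3 h4
  obtain ⟨hφ1, hφ2⟩ := goldenRatio_bounds
  have hφ := Real.goldenRatio_sq
  have hφ3 : φ ^ 3 = 2 * φ + 1 := by linear_combination (φ + 1) * hφ
  have hu : φ ^ 2 * u = φ * u + u := by rw [hφ]; ring
  have hv : φ ^ 2 * v = φ * v + v := by rw [hφ]; ring
  have hu3 : φ ^ 3 * u = 2 * (φ * u) + u := by rw [hφ3]; ring
  have hv3 : φ ^ 3 * v = 2 * (φ * v) + v := by rw [hφ3]; ring
  obtain ⟨a1, a2, a3, a4, a5⟩ := goldenRatio_multiples_pos h1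
  obtain ⟨b1, b2, b3, b4, b5⟩ := goldenRatio_multiples_pos h2
  obtain ⟨c1, c2, c3, c4, c5⟩ := goldenRatio_multiples_pos (sub_pos.2 h4)
  rw [reflect_tipToPlane, isBeyond_iff (j := 2) rfl, isBeyond_iff (j := 3) rfl]
  constructor <;> linarith

theorem reflect_tipToPlane_of_mem_tipA {q : ℝ × ℝ} (hq : q ∈ tipA) :
    -tipToPlane q + (2 : ℝ) • pentagonVertex 4 = rot (tipToPlane (tipMap q)) := by
  obtain ⟨u, v⟩ := q
  rw [tipMap_of_mem_tipA hq, reflect_tipToPlane]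
  have hs := sin_pi_div_five_sq
  have hφ := Real.goldenRatio_sq
  refine Prod.ext ?_ ?_ <;> simp only [rot, tipToPlane] <;>
    generalize Real.sin (Real.pi / 5) = s at * <;> generalize φ = t at *
  · grind
  · grind

theorem reflect_reflect_tipToPlane_of_mem_tipB {q : ℝ × ℝ} (hq : q ∈ tipB) :
    -(-tipToPlane q + (2 : ℝ) • pentagonVertex 4) + (2 : ℝ) • pentagonVertex 1 =
      rot^[3] (tipToPlane (tipMap q)) := by
  obtain ⟨u, v⟩ := q
  have e1 : pentagonVertex 1 = (Real.sin (Real.pi / 5) * φ, (φ - 1) / 2) := rfl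
  rw [tipMap_of_mem_tipB hq, reflect_tipToPlane, e1]
  have hs := sin_pi_div_five_sq
  have hφ := Real.goldenRatio_sq
  simp only [iterate_succ_apply, iterate_zero_apply, rot_rot]
  refine Prod.ext ?_ ?_ <;> simp only [rot, tipToPlane, Prod.fst_add, Prod.snd_add, Prod.fst_neg,
      Prod.snd_neg, Prod.smul_fst, Prod.smul_snd, smul_eq_mul] <;>
    generalize Real.sin (Real.pi / 5) = s at * <;> generalize φ = t at *
  · grind
  · grind

/-- The model together with the number of the arm of the pentagram: a visit to `tipA` moves one arm
clockwise, a visit to `tipB` three arms. -/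
def armMap (b : (ℝ × ℝ) × ZMod 5) : (ℝ × ℝ) × ZMod 5 :=
  (tipMap b.1, b.2 + (tipWeight 1 3 b.1 : ℕ))

/-- The point of the arm `b.2` with coordinates `b.1`; arm `0` is the tip at `genStar`. -/
def armToPlane (b : (ℝ × ℝ) × ZMod 5) : Option (ℝ × ℝ) :=
  some (rot^[b.2.val] (tipToPlane b.1))

theorem armToPlane_add (q : ℝ × ℝ) (i : ZMod 5) (n : ℕ) :
    armToPlane (q, i + n) = some (rot^[i.val] (rot^[n] (tipToPlane q))) := by
  have h : IsPeriodicPt rot 5 (tipToPlane q) := rot_iterate_five _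
  rw [armToPlane, ZMod.val_add, ZMod.val_natCast, Nat.add_mod_mod, h.iterate_mod_apply,
    iterate_add_apply]

theorem tipToPlane_injective : Injective tipToPlane := by
  rintro ⟨a, b⟩ ⟨c, d⟩ h
  have hs := sin_pi_div_five_pos.ne'
  have h0 := Real.goldenRatio_pos
  have h1 : 1 + φ / 2 ≠ 0 := by positivity
  have h2 : 2 * φ + 2 ≠ 0 := by positivity
  simp only [tipToPlane, Prod.mk.injEq, sub_left_inj, mul_right_inj' h1, mul_right_inj' hs] at h
  obtain ⟨h3, rfl⟩ := h
  rw [add_right_inj, mul_right_inj' h2] at h3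
  rw [h3]

theorem rot_injective : Injective rot :=
  LeftInverse.injective (g := rot^[4]) rot_iterate_five

/-- The tangent map returns to the points that lie beyond exactly one edge of the pentagon. This set
contains the five tips of the pentagram, and the edge in question tells in which of them a point
lies. -/
theorem isReturnSystem_armToPlane :
    IsReturnSystem (fun o : Option (ℝ × ℝ) => o.bind (tangentMap mom))
      {o | ∃ p, o = some p ∧ ∃! j, IsBeyond j p} armMap armToPlane
      (fun b => tipWeight 1 2 b.1) {b | b.1 ∈ tipDomain} where
  mapsTo b hb := mapsTo_tipDomain hb
  injOn := by
    rintro ⟨q, i⟩ hq ⟨q', i'⟩ hq' h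
    have h := Option.some.inj h
    have hi : (1 : ZMod 5) + i.val = 1 + i'.val := by
      rw [← isBeyond_rot_iterate_tipToPlane (tipDomain_subset_tip hq'), ← h,
        isBeyond_rot_iterate_tipToPlane (tipDomain_subset_tip hq)]
    simp only [ZMod.natCast_val, ZMod.cast_id', id_eq, add_right_inj] at hi
    subst hi
    exact Prod.ext (tipToPlane_injective (rot_injective.iterate _ h)) rfl
  pos b _ := by simp only [tipWeight]; split_ifs <;> norm_num
  mem b hb := ⟨_, rfl, 1 + (b.2.val : ZMod 5),
    (isBeyond_rot_iterate_tipToPlane (tipDomain_subset_tip hb) _ _).2 rfl,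
    fun j hj => (isBeyond_rot_iterate_tipToPlane (tipDomain_subset_tip hb) _ _).1 hj⟩
  iterate_eq := by
    rintro ⟨q, i⟩ hq
    have e₁ := tangentMap_rot_iterate (isContact_tip (tipDomain_subset_tip hq)) i.val
    rw [armMap, armToPlane_add]
    rcases mem_union_of_mem_tipDomain hq with h | h
    · simp only [tipWeight_of_mem_tipA h, iterate_succ_apply, iterate_zero_apply, armToPlane,
        Option.bind_some, e₁, reflect_tipToPlane_of_mem_tipA h]
    · have e₂ := tangentMap_rot_iterate (isContact_tipB h) i.val
      rw [reflect_reflect_tipToPlane_of_mem_tipB h] at e₂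
      simp only [tipWeight_of_mem_tipB h]
      simp only [iterate_succ_apply (fun o : Option (ℝ × ℝ) => o.bind (tangentMap mom)),
        iterate_zero_apply, armToPlane, Option.bind_some, e₁, e₂]
  notMem := by
    rintro ⟨q, i⟩ hq j hj hj'
    have e₁ := tangentMap_rot_iterate (isContact_tip (tipDomain_subset_tip hq)) i.val
    rcases mem_union_of_mem_tipDomain hq with h | h
    · simp only [tipWeight_of_mem_tipA h] at hj'
      omega
    · simp only [tipWeight_of_mem_tipB h] at hj'
      obtain rfl : j = 1 := by omega
      simp only [iterate_one, armToPlane, Option.bind_some, e₁]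
      rintro ⟨p, hp, hex⟩
      obtain rfl := Option.some.inj hp
      obtain ⟨b2, b3⟩ := isBeyond_reflect_tipToPlane h
      have := hex.unique ((isBeyond_rot_iterate i.val).2 b2) ((isBeyond_rot_iterate i.val).2 b3)
      exact absurd (add_right_cancel this) (by decide)

/-! ### The periods of the tangent map -/

theorem armMap_iterate (m : ℕ) (q : ℝ × ℝ) (i : ZMod 5) :
    armMap^[m] (q, i) = (tipMap^[m] q, i + (birkhoffSum tipMap (tipWeight 1 3) m q : ℕ)) := by
  induction m with
  | zero => simp
  | succ m ih =>
    rw [iterate_succ_apply', ih, armMap, iterate_succ_apply', birkhoffSum_succ, Nat.cast_add,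
      add_assoc]

theorem birkhoffSum_mul_minimalPeriod {α : Type*} (f : α → α) (w : α → ℕ) (x : α) (m : ℕ) :
    birkhoffSum f w (minimalPeriod f x * m) x = m * birkhoffSum f w (minimalPeriod f x) x := by
  induction m with
  | zero => simp
  | succ m ih =>
    rw [Nat.mul_succ, birkhoffSum_add, ih, iterate_mul,
      (isPeriodicPt_minimalPeriod f x).isFixedPt.iterate m]
    ring

/-- Five turns through the arms are needed before a periodic orbit of the model closes up, when the
total shift over one period of the model is not a multiple of five. -/
theorem minimalPeriod_armMap {q : ℝ × ℝ}
    (h5 : ¬ 5 ∣ birkhoffSum tipMap (tipWeight 1 3) (minimalPeriod tipMap q) q) :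
    minimalPeriod armMap (q, 0) = minimalPeriod tipMap q * 5 := by
  have key (m : ℕ) : IsPeriodicPt armMap m (q, 0) ↔ minimalPeriod tipMap q * 5 ∣ m := by
    rw [IsPeriodicPt, IsFixedPt, armMap_iterate, Prod.mk.injEq, zero_add,
      ZMod.natCast_eq_zero_iff]
    constructor
    · rintro ⟨h1, h2⟩
      obtain ⟨n, rfl⟩ := IsPeriodicPt.minimalPeriod_dvd h1
      rw [birkhoffSum_mul_minimalPeriod] at h2
      exact mul_dvd_mul_left _ (((Nat.Prime.dvd_mul Nat.prime_five).1 h2).resolve_right h5)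
    · rintro ⟨n, rfl⟩
      rw [mul_assoc, birkhoffSum_mul_minimalPeriod, mul_assoc]
      exact ⟨(isPeriodicPt_minimalPeriod tipMap q).mul_const _, dvd_mul_right _ _⟩
  exact Nat.dvd_antisymm (((key _).2 dvd_rfl).minimalPeriod_dvd)
    ((key _).1 (isPeriodicPt_minimalPeriod _ _))

theorem regionPeriod_dad (k : ℕ) :
    regionPeriod mom (dad (k + 1)) = 5 * ((tipVisits k).1 + (tipVisits k).2 * 2) := by
  obtain ⟨hD, hper⟩ := tipCenter_mem k
  have h5 := not_five_dvd_tipVisits k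
  rw [← mul_one (tipVisits k).1, ← birkhoffSum_tipCenter] at h5
  have hmin := minimalPeriod_armMap h5
  have hper' : (tipCenter (k + 1), (0 : ZMod 5)) ∈ periodicPts armMap := by
    rw [← minimalPeriod_pos_iff_mem_periodicPts, hmin]
    exact Nat.mul_pos (minimalPeriod_pos_of_mem_periodicPts hper) (by norm_num)
  have e : armToPlane (tipCenter (k + 1), 0) = some (dad (k + 1)).center := by
    rw [dad_center_eq, armToPlane, ZMod.val_zero, iterate_zero_apply]
  have hfst (m : ℕ) : birkhoffSum armMap (fun b => (tipWeight 1 2 b.1 : ℕ)) m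
      (tipCenter (k + 1), 0) = birkhoffSum tipMap (tipWeight 1 2) m (tipCenter (k + 1)) := by
    simp only [birkhoffSum, armMap_iterate]
  rw [regionPeriod, tangentPeriod, ← e, isReturnSystem_armToPlane.minimalPeriod_eq hD hper', hmin,
    hfst, birkhoffSum_mul_minimalPeriod, birkhoffSum_tipCenter, mul_one]

end OuterBilliard

end

theorem mainTheorem2 (k : ℕ) (hk : 1 ≤ k) :
    ((OuterBilliard.regionPeriod OuterBilliard.mom (OuterBilliard.dad k) : ℤ) =
      2 * (OuterBilliard.dfPeriod (2 * Real.pi / 10)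
        (OuterBilliard.tsToDf (2 * Real.pi / 10) (OuterBilliard.cDad k)) : ℤ) + (-1) ^ k) ∧
    ((OuterBilliard.regionPeriod OuterBilliard.mom (OuterBilliard.dad k) : ℚ) =
      5 / 7 * (8 * 6 ^ (k - 1) + (-1) ^ k)) := by
  obtain ⟨k, rfl⟩ : ∃ m, k = m + 1 := ⟨k - 1, by omega⟩
  have h1 := OuterBilliard.two_mul_tipVisits_sub k
  have h2 := congrArg (Int.cast : ℤ → ℚ) (OuterBilliard.seven_mul_tipVisits_add k)
  rw [OuterBilliard.regionPeriod_dad, OuterBilliard.dfPeriod_cDad, Nat.add_sub_cancel]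
  push_cast at h2 ⊢
  constructor
  · linear_combination h1
  · linear_combination 5 / 7 * h2
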